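/- For $m\ge 1$ let $\mathcal N_2\cap\mathcal B_m$ denote the variety of all groups $G$ that are nilpotent of class at most two (that is, $[G,G]\subseteq Z(G)$) and of exponent $m$ (that is, $g^m=e$ for all $g\in G$). Let $\mathcal C$ be such a variety. A special amalgam of $\mathcal C$-groups with core $B$ consists of groups $A,A'\in\mathcal C$, injective homomorphisms $\Phi\colon B\to A$ and $\Phi'\colon B\to A'$, such that there is an isomorphism $\psi\colon A\to A'$ with $\psi\circ\Phi=\Phi'$. It is strongly embeddable in $\mathcal C$ if there are a group $M\in\mathcal C$ and injective homomorphisms $\lambda\colon A\to M$, $\lambda'\colon A'\to M$ with $\lambda\circ\Phi=\lambda'\circ\Phi'$ and $\lambda(a)\ne\lambda'(a')$ for all $a\in A\setminus\Phi(B)$ and $a'\in A'\setminus\Phi'(B)$. A group $B\in\mathcal C$ is absolutely closed in $\mathcal C$ (a special amalgamation base for $\mathcal C$) if every special amalgam of $\mathcal C$-groups with core $B$ is strongly embeddable in $\mathcal C$. **Theorem.** Let $p$ be an odd prime and let $n>0$ be an integer. Let $$G=\left\langle x,y \;\middle|\; x^{p^n}=y^{p^n}=[x,y]^{p^{n-1}}=e\right\rangle,$$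 the presentation being taken in the variety $\mathcal N_2$ of nilpotent groups of class at most two (so the identity $[[a,b],c]=e$ is imposed in addition to the relations shown, where $[a,b]=a^{-1}b^{-1}ab$). Then $G$ belongs to $\mathcal N_2\cap\mathcal B_{p^n}$, $G$ is absolutely closed in $\mathcal N_2\cap\mathcal B_{p^n}$, and $G$ is not absolutely closed in $\mathcal N_2\cap\mathcal B_{p^{n+1}}$. -/

import Mathlib

universe u v

/-- The commutator `[a, b] = a⁻¹ b⁻¹ a b`. -/
def grpComm {G : Type v} [Group G] (a b : G) : G := a⁻¹ * b⁻¹ * a * b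

/-- Membership in the variety of nilpotent groups of class at most two: `[G, G] ⊆ Z(G)`. -/
def IsNilTwo (G : Type v) [Group G] : Prop :=
  commutator G ≤ Subgroup.center G

/-- Membership in the variety of all groups of exponent `m`, i.e. satisfying the law `g ^ m = e`. -/
def HasExp (m : ℕ) (G : Type v) [Group G] : Prop :=
  ∀ g : G, g ^ m = 1

/-- Membership in the variety of nilpotent groups of class at most two and of exponent `m`. -/
def IsNilTwoExp (m : ℕ) (G : Type v) [Group G] : Prop :=
  IsNilTwo G ∧ HasExp m G

/-- The group presented, within the variety of nilpotent groups of class at most two, by the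
generators `α` and the relators `rels`: besides the relators, the law `[a, b, c] = e` is imposed. -/
abbrev NilTwoPresented {α : Type v} (rels : Set (FreeGroup α)) : Type v :=
  PresentedGroup (rels ∪ {t | ∃ a b c : FreeGroup α, t = grpComm (grpComm a b) c})

/-- `A` and `A'`, with the maps `Φ` and `Φ'` from `B`, form a special amalgam with core `B`. -/
def IsSpecialAmalgam {B : Type v} {A A' : Type u} [Group B] [Group A] [Group A']
    (Φ : B →* A) (Φ' : B →* A') : Prop :=
  Function.Injective Φ ∧ Function.Injective Φ' ∧
    ∃ ψ : A ≃* A', ψ.toMonoidHom.comp Φ = Φ'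

/-- The amalgam of `A` and `A'` with core `B` is strongly embeddable in the class `C` of groups:
some `C`-group receives compatible embeddings of `A`, `A'` and `B` which identify no element of
`A` outside `B` with an element of `A'` outside `B`. -/
def StronglyEmbeddable (C : (H : Type u) → [Group H] → Prop)
    {B : Type v} {A A' : Type u} [Group B] [Group A] [Group A']
    (Φ : B →* A) (Φ' : B →* A') : Prop :=
  ∃ (M : Type u) (_ : Group M), C M ∧
    ∃ (l : A →* M) (l' : A' →* M) (l₀ : B →* M),
      Function.Injective l ∧ Function.Injective l' ∧ Function.Injective l₀ ∧
      l.comp Φ = l₀ ∧ l'.comp Φ' = l₀ ∧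
      ∀ a : A, a ∉ Φ.range → ∀ a' : A', a' ∉ Φ'.range → l a ≠ l' a'

/-- `B` is a special amalgamation base for the class `C` of groups, or absolutely closed in `C`:
every special amalgam of `C`-groups with core `B` is strongly embeddable in `C`.
(That `B` itself belongs to `C` is stated separately.) -/
def AbsolutelyClosed (C : (H : Type u) → [Group H] → Prop) (B : Type v) [Group B] : Prop :=
  ∀ (A A' : Type u) [Group A] [Group A'], C A → C A' →
    ∀ (Φ : B →* A) (Φ' : B →* A'), IsSpecialAmalgam Φ Φ' → StronglyEmbeddable C Φ Φ'

/-- The relators `x ^ (p ^ n)`, `y ^ (p ^ n)` and `[x, y] ^ (p ^ (n - 1))`, for `n ≥ 1`. -/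
def baseRels (p n : ℕ) : Set (FreeGroup (Fin 2)) :=
  {FreeGroup.of 0 ^ p ^ n, FreeGroup.of 1 ^ p ^ n,
    grpComm (FreeGroup.of 0) (FreeGroup.of 1) ^ p ^ (n - 1)}

/-- The group `⟨x, y ∣ x ^ (p ^ n) = y ^ (p ^ n) = [x, y] ^ (p ^ (n - 1)) = e⟩`, presented within
the nilpotent groups of class at most two. -/
abbrev BaseGroup (p n : ℕ) : Type := NilTwoPresented (baseRels p n)

open scoped commutatorElement IsMulCommutative

/-! ### Bilinear forms on abelian groups of bounded exponent -/

/-! Write `B` for the given group. In exponent `p ^ n`, let `A` contain `B`, put `V = A/[A, A]` and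
`T = Z(A)/(Z(A) ∩ B)`. The commutator induces an alternating form `α` on `V` with values in `Z(A)`.
The point is to write its reduction to `T` as `β s t - β t s` for a bilinear `β` that vanishes
whenever its second argument comes from `B`. Such a `β` twists `A × A` by `T` into a class-two group
of odd exponent, in which two copies of `A` can be glued along `B` and nothing more
(`stronglyEmbeddable_of_form`).

To find `β`, split cyclic summands off `V`. For one element `r`, `exists_antisymm_eq_of_pow_smul`
always succeeds: `r` is congruent modulo `p` to a generator of a summand, and the error `p • g` is
handled recursively until it is killed, where oddness allows halving `α`. For the two generators
`x`, `y` of `B`, some combination must generate a summand independent of another. That `[x, y]` has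
order exactly `p ^ (n - 1)` guarantees this (`exists_antisymm_eq_of_order`).

In exponent `p ^ (n + 1)`, `x` and `y` acquire `p`-th roots `r`, `s` in some overgroup. There `[r,
s] ^ p` lies outside `B`, yet bilinearity of commutators forces any two copies of it to coincide. -/

theorem ZMod.dvd_of_annihilator {N : ℕ} [NeZero N] (e t : ZMod N)
    (h : ∀ c : ZMod N, c * e = 0 → c * t = 0) : e ∣ t := by
  obtain ⟨E, rfl⟩ := ZMod.natCast_zmod_surjective e
  obtain ⟨F, rfl⟩ := ZMod.natCast_zmod_surjective t
  have hN : 0 < N := Nat.pos_of_neZero N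
  have hd0 : 0 < Nat.gcd E N := Nat.gcd_pos_of_pos_right _ hN
  obtain ⟨M, hM⟩ := Nat.gcd_dvd_right E N
  obtain ⟨E', hE'⟩ := Nat.gcd_dvd_left E N
  -- The cofactor `M = N / gcd E N` kills `e`, hence `t`. This makes `gcd E N` divide `F`, and by
  -- Bézout the gcd is a multiple of `E` modulo `N`.
  have h1 := h (M : ZMod N) (by
    rw [← Nat.cast_mul, ZMod.natCast_eq_zero_iff]
    exact ⟨E', by rw [mul_comm]; nth_rw 1 [hE']; rw [mul_right_comm, ← hM]⟩)
  rw [← Nat.cast_mul, ZMod.natCast_eq_zero_iff] at h1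
  have hM0 : 0 < M := Nat.pos_of_ne_zero (by rintro rfl; omega)
  have h2 : Nat.gcd E N ∣ F := by
    obtain ⟨q, hq⟩ := h1
    refine ⟨q, Nat.eq_of_mul_eq_mul_left hM0 ?_⟩
    rw [hq]; nth_rw 1 [hM]; ring
  have h3 : (E : ZMod N) ∣ ((Nat.gcd E N : ℕ) : ZMod N) := by
    refine ⟨((Nat.gcdA E N : ℤ) : ZMod N), ?_⟩
    have := congrArg (fun z : ℤ => (z : ZMod N)) (Nat.gcd_eq_gcd_ab E N)
    simpa using this
  exact h3.trans (Nat.cast_dvd_cast h2)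

/-- Ideals are principal, and the image of a generator `e` is killed by the annihilator of `e`, so
it is a multiple of `e`; multiplication by the quotient extends the map. This self-injectivity is
the source of all coordinate maps. -/
theorem ZMod.baer (N : ℕ) [NeZero N] : Module.Baer (ZMod N) (ZMod N) := by
  intro I g
  have : IsPrincipalIdealRing (ZMod N) :=
    IsPrincipalIdealRing.of_surjective (Int.castRingHom (ZMod N)) ZMod.intCast_surjective
  obtain ⟨e, rfl⟩ := (IsPrincipalIdealRing.principal I).principal
  have he : e ∈ Submodule.span (ZMod N) {e} := Submodule.mem_span_singleton_self e
  obtain ⟨q, hq⟩ := ZMod.dvd_of_annihilator e (g ⟨e, he⟩) (by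
    intro c hc
    rw [← smul_eq_mul, ← map_smul]
    have : c • (⟨e, he⟩ : Submodule.span (ZMod N) {e}) = 0 := Subtype.ext hc
    rw [this, map_zero])
  refine ⟨LinearMap.toSpanSingleton (ZMod N) (ZMod N) q, ?_⟩
  intro x hx
  obtain ⟨c, rfl⟩ := Submodule.mem_span_singleton.1 hx
  have : (⟨c • e, hx⟩ : Submodule.span (ZMod N) {e}) = c • ⟨e, he⟩ := rfl
  rw [this, map_smul g, hq]
  simp [mul_left_comm, mul_comm]

theorem ZMod.exists_linearMap_apply_eq_one {N : ℕ} [NeZero N] {W : Type*} [AddCommGroup W]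
    [Module (ZMod N) W] (f : W) (h : ∀ a : ZMod N, a • f = 0 → a = 0) :
    ∃ κ : W →ₗ[ZMod N] ZMod N, κ f = 1 := by
  have hi : Function.Injective (LinearMap.toSpanSingleton (ZMod N) W f) := by
    rw [← LinearMap.ker_eq_bot, LinearMap.ker_eq_bot']
    exact h
  obtain ⟨κ, hκ⟩ := (ZMod.baer N).extension_property _ hi LinearMap.id
  exact ⟨κ, by simpa using LinearMap.congr_fun hκ 1⟩

section Additive

variable {V : Type u} [AddCommGroup V]

/-- An element that is independent of `x` modulo `N • V` is a coordinate for a map to `ZMod N`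
which vanishes at `x`. -/
theorem exists_coordinate (N : ℕ) [NeZero N] (f x : V)
    (h : ∀ (g : V) (a b : ℤ), N • g = a • f + b • x → (N : ℤ) ∣ a) :
    ∃ κ : V →ₗ[ℤ] ZMod N, κ f = 1 ∧ κ x = 0 := by
  let S : AddSubgroup V := (nsmulAddMonoidHom (α := V) N).range ⊔ AddSubgroup.zmultiples x
  have hS : ∀ w : V ⧸ S, N • w = 0 := by
    intro w
    obtain ⟨v, rfl⟩ := QuotientAddGroup.mk_surjective w
    rw [← QuotientAddGroup.mk_nsmul, QuotientAddGroup.eq_zero_iff]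
    exact AddSubgroup.mem_sup_left ⟨v, rfl⟩
  obtain ⟨κ, hκ⟩ : ∃ κ : V ⧸ S →+ ZMod N, κ (QuotientAddGroup.mk f) = 1 := by
    -- The hypothesis says that `f` keeps order `N` modulo `N • V + ⟨x⟩`, so its image spans a free
    -- submodule there.
    let _ : Module (ZMod N) (V ⧸ S) := AddCommGroup.zmodModule hS
    obtain ⟨κ, hκ⟩ := ZMod.exists_linearMap_apply_eq_one (N := N)
      (QuotientAddGroup.mk f : V ⧸ S) (by
        intro m hm
        obtain ⟨a, rfl⟩ := ZMod.intCast_surjective m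
        rw [Int.cast_smul_eq_zsmul, ← QuotientAddGroup.mk_zsmul,
          QuotientAddGroup.eq_zero_iff] at hm
        obtain ⟨y, ⟨g, rfl⟩, z, hz, hyz⟩ := AddSubgroup.mem_sup.1 hm
        obtain ⟨b, rfl⟩ := AddSubgroup.mem_zmultiples_iff.1 hz
        rw [ZMod.intCast_zmod_eq_zero_iff_dvd]
        refine h g a (-b) ?_
        rw [← hyz]; simp)
    exact ⟨κ.toAddMonoidHom, hκ⟩
  refine ⟨(κ.comp (QuotientAddGroup.mk' S)).toIntLinearMap, ?_, ?_⟩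
  · simpa using hκ
  · have : (QuotientAddGroup.mk x : V ⧸ S) = 0 :=
      (QuotientAddGroup.eq_zero_iff _).2 (AddSubgroup.mem_sup_right (AddSubgroup.mem_zmultiples x))
    simp [this]

/-- The homomorphism from `ZMod N` that sends `1` to `t`. -/
theorem exists_lift_zmod (N : ℕ) (t : V) (ht : N • t = 0) :
    ∃ ι : ZMod N →ₗ[ℤ] V, ∀ m : ℤ, ι (m : ZMod N) = m • t := by
  refine ⟨(ZMod.lift N ⟨zmultiplesHom V t, by simpa using ht⟩).toIntLinearMap, ?_⟩
  intro m
  simp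

/-- Modulo `p • V`, every element is congruent to a generator of a direct summand. -/
theorem exists_summand_congr {p n : ℕ} (hp : p.Prime) (hV : ∀ v : V, p ^ n • v = 0) (r : V) :
    ∃ (k : ℕ) (f g : V) (κ : V →ₗ[ℤ] ZMod (p ^ k)),
      p ^ k • f = 0 ∧ κ f = 1 ∧ κ r = 1 ∧ r = f + p • g := by
  classical
  -- An element of least order in the class of `r` modulo `p • V` generates a pure cyclic subgroup,
  -- hence a summand.
  have hex : ∃ k, ∃ g : V, p ^ k • (r - p • g) = 0 := ⟨n, 0, hV _⟩
  obtain ⟨g, hg⟩ := Nat.find_spec hex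
  have hmin := fun j (hj : j < Nat.find hex) => Nat.find_min hex hj
  generalize Nat.find hex = k at hg hmin
  have : NeZero (p ^ k) := ⟨(pow_pos hp.pos k).ne'⟩
  have hdvd : ∀ (g' : V) (a b : ℤ), p ^ k • g' = a • (r - p • g) + b • (0 : V) →
      ((p ^ k : ℕ) : ℤ) ∣ a := by
    intro g' a b h
    by_contra hna
    rw [smul_zero, add_zero] at h
    have hpz : Prime (p : ℤ) := Nat.prime_iff_prime_int.1 hp
    have ha0 : a ≠ 0 := by rintro rfl; simp at hna
    obtain ⟨u, hu, hdvu⟩ := (Int.finiteMultiplicity_iff.2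
      ⟨by simpa using hp.one_lt.ne', ha0⟩ :
        FiniteMultiplicity (p : ℤ) a).exists_eq_pow_mul_and_not_dvd
    generalize multiplicity (p : ℤ) a = j at hu
    have hjk : j < k := by
      by_contra hle
      exact hna (by rw [hu, Nat.cast_pow]; exact Dvd.dvd.mul_right (pow_dvd_pow _ (by omega)) _)
    obtain ⟨c, d, hcd⟩ : IsCoprime u ((p : ℤ) ^ n) :=
      IsCoprime.pow_right ((hpz.coprime_iff_not_dvd.2 hdvu).symm)
    -- As `a = p ^ j * u` and `c` inverts `u` modulo `p ^ n`, this correction gives an element of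
    -- the same class killed by `p ^ j`.
    refine hmin j hjk ⟨g + p ^ (k - j - 1) • c • g', ?_⟩
    obtain ⟨i, rfl⟩ : ∃ i, k = j + (i + 1) := ⟨k - j - 1, by omega⟩
    have e1 : j + (i + 1) - j - 1 = i := by omega
    have h2 : ((p : ℤ) ^ n) • (r - p • g) = 0 := by
      have := hV (r - p • g)
      rwa [← natCast_zsmul, Nat.cast_pow] at this
    rw [e1]
    simp only [← natCast_zsmul, Nat.cast_pow] at h h2 ⊢
    rw [hu] at h
    linear_combination (norm := module) -c • h + (d * (p : ℤ) ^ j) • h2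
      - hcd • ((p : ℤ) ^ j • r - (p : ℤ) ^ (j + 1) • g)
  obtain ⟨κ, hκ, -⟩ := exists_coordinate (p ^ k) (r - p • g) 0 hdvd
  obtain ⟨G, hG⟩ := ZMod.intCast_surjective (κ g)
  have hr : κ r = 1 + p * G := by
    have : r = (r - p • g) + p • g := by abel
    rw [this, map_add, hκ, map_nsmul, hG, nsmul_eq_mul]
  have hu : IsUnit (1 + p * G : ZMod (p ^ k)) := by
    refine IsNilpotent.isUnit_one_add ⟨k, ?_⟩
    rw [mul_pow, ← Nat.cast_pow, ZMod.natCast_self, zero_mul]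
  obtain ⟨w, hw⟩ := hu.exists_left_inv
  -- Rescaling the generator by the unit `κ r` and the coordinate by its inverse makes both `f` and
  -- `r` have coordinate `1`.
  refine ⟨k, (1 + p * G) • (r - p • g), g - G • (r - p • g),
    (LinearMap.mulLeft ℤ w).comp κ, ?_, ?_, ?_, ?_⟩
  · rw [smul_comm, hg, smul_zero]
  · simp only [LinearMap.comp_apply, map_zsmul, hκ, LinearMap.mulLeft_apply]
    rw [zsmul_eq_mul, mul_one, ← hw, mul_comm]; push_cast; ring
  · simp [hr, hw]
  · simp only [← natCast_zsmul]
    module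

/-- An alternating form on a group of odd bounded exponent is the antisymmetrisation of a bilinear
form that vanishes identically when its second argument is a given element. -/
theorem exists_antisymm_eq_of_pow_smul {T : Type v} [AddCommGroup T] {p n : ℕ} (hp : p.Prime)
    (hodd : Odd p) (hV : ∀ v : V, p ^ n • v = 0) (i : ℕ) :
    ∀ j, j + i = n → ∀ (α : V →ₗ[ℤ] V →ₗ[ℤ] T), (∀ v, α v v = 0) → ∀ r : V,
      ∃ β : V →ₗ[ℤ] V →ₗ[ℤ] T, (∀ s t, β s t - β t s = α s t) ∧ ∀ s, β s (p ^ j • r) = 0 := by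
  induction i with
  | zero =>
    intro j hj α hα r
    obtain rfl : j = n := by omega
    obtain ⟨c, hc⟩ := hodd.pow (n := j)
    have hneg : ∀ s t, α t s = - α s t := fun s t => by
      have := LinearMap.IsAlt.neg (B := α) hα s t
      rw [← this]
    -- Since `2 * c + 1` kills `V`, `c + 1` acts as `1/2`.
    refine ⟨(c + 1 : ℤ) • α, fun s t => ?_, fun s => by rw [hV, map_zero]⟩
    have h0 : (2 * (c : ℤ) + 1) • α s t = 0 := by
      have h1 : (2 * (c : ℤ) + 1) • s = 0 := by
        have := hV s
        rw [hc, ← natCast_zsmul] at this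
        exact_mod_cast this
      rw [← LinearMap.smul_apply, ← map_smul, h1]; simp
    simp only [LinearMap.smul_apply]
    rw [hneg s t]
    linear_combination (norm := module) h0
  | succ i ih =>
    intro j hj α hα r
    obtain ⟨k, f, g, κ, hf, hκf, hκr, hr⟩ := exists_summand_congr hp hV r
    obtain ⟨ι, hι⟩ := exists_lift_zmod (p ^ k) f hf
    let e : V →ₗ[ℤ] V := LinearMap.id - ι.comp κ
    obtain ⟨β, hβ, hβr⟩ := ih (j + 1) (by omega) (α.compl₁₂ e e) (fun v => hα _) g
    have ht : p ^ k • (-(p • α f g)) = 0 := by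
      have : p ^ k • α f g = 0 := by
        rw [← LinearMap.smul_apply, ← map_nsmul, hf]; simp
      rw [smul_neg, smul_comm, this]; simp
    obtain ⟨ιT, hιT⟩ := exists_lift_zmod (p ^ k) (-(p • α f g)) ht
    have hκι : ∀ s, κ (ι (κ s)) = κ s := by
      intro s
      obtain ⟨m, hm⟩ := ZMod.intCast_surjective (κ s)
      rw [← hm, hι, map_zsmul, hκf]; simp
    have hee : ∀ s, e (e s) = e s := by
      intro s
      simp [e, hκι]
    have her : e r = p • g := by
      have : ι 1 = f := by simpa using hι 1
      simp only [e, LinearMap.sub_apply, LinearMap.id_apply, LinearMap.comp_apply, hκr, this]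
      rw [hr]; abel
    -- On `⟨f⟩ ⊕ ker κ` the first term treats the complement and the second the mixed part of `α`.
    -- The third is symmetric, so it does not affect the antisymmetrisation; its value `-p • α f g`
    -- cancels what the second gives at `p ^ j • r`, because `e r = p • g`.
    refine ⟨β.compl₁₂ e e + α.compl₁₂ (ι.comp κ) e
      + ((LinearMap.mul ℤ (ZMod (p ^ k))).compr₂ ιT).compl₁₂ κ κ, fun s t => ?_, fun s => ?_⟩
    · have h1 := hβ (e s) (e t)
      have h2 : α (ι (κ s)) (ι (κ t)) = 0 := by
        obtain ⟨m, hm⟩ := ZMod.intCast_surjective (κ s)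
        obtain ⟨m', hm'⟩ := ZMod.intCast_surjective (κ t)
        rw [← hm, ← hm', hι, hι]; simp [hα]
      have h3 : ∀ s t, α t s = - α s t := fun s t => by
        have := LinearMap.IsAlt.neg (B := α) hα s t
        rw [← this]
      simp only [LinearMap.compl₁₂_apply, hee] at h1
      have he : ∀ s, e s = s - ι (κ s) := fun s => rfl
      simp only [LinearMap.add_apply, LinearMap.compl₁₂_apply, LinearMap.compr₂_apply,
        LinearMap.mul_apply', mul_comm (κ t) (κ s), LinearMap.comp_apply]
      have h4 := h3 (ι (κ t)) s
      have h5 := h3 (ι (κ t)) (ι (κ s))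
      simp only [he, map_sub, LinearMap.sub_apply] at h1 ⊢
      linear_combination (norm := module) h1 - h2 - h4 + h5
    · obtain ⟨m, hm⟩ := ZMod.intCast_surjective (κ s)
      have h6 : κ s * κ (p ^ j • r) = ((m * p ^ j : ℤ) : ZMod (p ^ k)) := by
        rw [map_nsmul, hκr, ← hm]; simp
      have h7 : e (p ^ j • r) = p ^ (j + 1) • g := by
        rw [map_nsmul, her, smul_smul, pow_succ]
      simp only [LinearMap.add_apply, LinearMap.compl₁₂_apply, LinearMap.compr₂_apply,
        LinearMap.mul_apply', LinearMap.comp_apply, h6, hιT, h7, hβr]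
      rw [← hm, hι]
      simp only [map_zsmul, LinearMap.smul_apply, ← natCast_zsmul]
      push_cast
      module

/-- Splitting off a second element, which generates a direct summand. -/
theorem exists_antisymm_eq_of_coordinate {T : Type v} [AddCommGroup T] {p n N : ℕ} (hp : p.Prime)
    (hodd : Odd p) (hV : ∀ v : V, p ^ n • v = 0) (α : V →ₗ[ℤ] V →ₗ[ℤ] T)
    (hα : ∀ v, α v v = 0) (x y : V) (hxy : α y x = 0) (hy : N • y = 0)
    (κ : V →ₗ[ℤ] ZMod N) (hκy : κ y = 1) (hκx : κ x = 0) :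
    ∃ β : V →ₗ[ℤ] V →ₗ[ℤ] T, (∀ s t, β s t - β t s = α s t) ∧
      (∀ s, β s x = 0) ∧ ∀ s, β s y = 0 := by
  obtain ⟨ι, hι⟩ := exists_lift_zmod N y hy
  let e : V →ₗ[ℤ] V := LinearMap.id - ι.comp κ
  have he : ∀ s, e s = s - ι (κ s) := fun s => rfl
  have hex : e x = x := by simp [he, hκx]
  have hey : e y = 0 := by
    have : ι 1 = y := by simpa using hι 1
    simp [he, hκy, this]
  have hee : ∀ s, e (e s) = e s := by
    intro s
    have : e (ι (κ s)) = 0 := by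
      obtain ⟨m, hm⟩ := ZMod.intCast_surjective (κ s)
      rw [← hm, hι, map_zsmul, hey, smul_zero]
    rw [he s, map_sub, this, sub_zero, he]
  obtain ⟨β, hβ, hβx⟩ := exists_antisymm_eq_of_pow_smul hp hodd hV n 0 (by omega)
    (α.compl₁₂ e e) (fun v => hα _) x
  -- Both terms vanish at `y` because `e y = 0`. At `x`, which lies in the complement, the mixed
  -- term is a multiple of `α y x = 0`.
  refine ⟨β.compl₁₂ e e + α.compl₁₂ (ι.comp κ) e, fun s t => ?_, fun s => ?_, fun s => ?_⟩
  · have h1 := hβ (e s) (e t)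
    have h2 : α (ι (κ s)) (ι (κ t)) = 0 := by
      obtain ⟨m, hm⟩ := ZMod.intCast_surjective (κ s)
      obtain ⟨m', hm'⟩ := ZMod.intCast_surjective (κ t)
      rw [← hm, ← hm', hι, hι]; simp [hα]
    have h3 : ∀ s t, α t s = - α s t := fun s t => by
      have := LinearMap.IsAlt.neg (B := α) hα s t
      rw [← this]
    simp only [LinearMap.compl₁₂_apply, hee] at h1
    simp only [LinearMap.add_apply, LinearMap.compl₁₂_apply, LinearMap.comp_apply]
    have h4 := h3 (ι (κ t)) s
    have h5 := h3 (ι (κ t)) (ι (κ s))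
    simp only [he, map_sub, LinearMap.sub_apply] at h1 ⊢
    linear_combination (norm := module) h1 - h2 - h4 + h5
  · obtain ⟨m, hm⟩ := ZMod.intCast_surjective (κ s)
    have := hβx (e s)
    rw [pow_zero, one_smul] at this
    simp only [LinearMap.add_apply, LinearMap.compl₁₂_apply, LinearMap.comp_apply, hex, this,
      ← hm, hι]
    simp [hxy]
  · simp [hey]

/-- `hdet` says that the pairs `(a, b)` modulo `p` with `p ^ k • (a • x + b • y)` in `p ^ (k + 1) •
V` span at most a line. A generator off that line splits off a summand, after a change of basis that
puts the other one on it. -/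
theorem exists_antisymm_eq_of_det {T : Type v} [AddCommGroup T] {p n k : ℕ} (hp : p.Prime)
    (hodd : Odd p) (hV : ∀ v : V, p ^ n • v = 0) (α : V →ₗ[ℤ] V →ₗ[ℤ] T)
    (hα : ∀ v, α v v = 0) (x y : V) (hxy : α x y = 0)
    (hx : p ^ (k + 1) • x = 0) (hy : p ^ (k + 1) • y = 0)
    (hdvd : ∀ (g : V) (a b : ℤ), p ^ (k + 1) • g = a • x + b • y →
      (p : ℤ) ^ k ∣ a ∧ (p : ℤ) ^ k ∣ b)
    (hdet : ∀ (g h : V) (a b c d : ℤ), p ^ (k + 1) • g = p ^ k • (a • x + b • y) →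
      p ^ (k + 1) • h = p ^ k • (c • x + d • y) → (p : ℤ) ∣ a * d - b * c) :
    ∃ β : V →ₗ[ℤ] V →ₗ[ℤ] T, (∀ s t, β s t - β t s = α s t) ∧
      (∀ s, β s x = 0) ∧ ∀ s, β s y = 0 := by
  have : NeZero (p ^ (k + 1)) := ⟨(pow_pos hp.pos _).ne'⟩
  have hyx : α y x = 0 := by
    have := LinearMap.IsAlt.neg (B := α) hα x y
    rw [← this, hxy, neg_zero]
  by_cases hb : ∀ (g : V) (a b : ℤ), p ^ (k + 1) • g = p ^ k • (a • x + b • y) → (p : ℤ) ∣ b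
  · obtain ⟨κ, hκy, hκx⟩ := exists_coordinate (p ^ (k + 1)) y x (by
      intro g a b h
      rw [add_comm (a • y)] at h
      obtain ⟨⟨b', rfl⟩, ⟨a', rfl⟩⟩ := hdvd g b a h
      obtain ⟨c, rfl⟩ := hb g b' a' (by
        rw [h]; simp only [← natCast_zsmul]; push_cast; module)
      exact ⟨c, by push_cast; ring⟩)
    exact exists_antisymm_eq_of_coordinate hp hodd hV α hα x y hyx hy κ hκy hκx
  · push Not at hb
    obtain ⟨g₀, a₀, b₀, h₀, hb₀⟩ := hb
    obtain ⟨d, c, hcd⟩ : IsCoprime (p : ℤ) b₀ :=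
      (Nat.prime_iff_prime_int.1 hp).coprime_iff_not_dvd.2 hb₀
    -- Here `c` inverts `b₀` modulo `p`, so `(c * a₀, 1)` spans the bad line; `x` lies off it.
    obtain ⟨κ, hκx, hκy⟩ := exists_coordinate (p ^ (k + 1)) x ((c * a₀) • x + y) (by
      intro g a b h
      have h' : p ^ (k + 1) • g = (a + b * (c * a₀)) • x + b • y := by rw [h]; module
      obtain ⟨⟨a', ha'⟩, ⟨b', rfl⟩⟩ := hdvd g _ _ h'
      have h1 := hdet g g₀ a' b' a₀ b₀ (by
        rw [h', ha']; simp only [← natCast_zsmul]; push_cast; module) h₀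
      obtain ⟨z, hz⟩ := h1
      refine ⟨z * c + d * a', ?_⟩
      push_cast
      linear_combination ha' + (p : ℤ) ^ k * c * hz - (p : ℤ) ^ k * a' * hcd)
    obtain ⟨β, hβ, h1, h2⟩ := exists_antisymm_eq_of_coordinate hp hodd hV α hα
      ((c * a₀) • x + y) x (by simp [hα, hxy]) hx κ hκx hκy
    refine ⟨β, hβ, h2, fun s => ?_⟩
    have := h1 s
    rwa [map_add, map_zsmul, h2, smul_zero, zero_add] at this

/-- An alternating form `α` that takes a value of order `p ^ (n - 1)` at `(x, y)` becomes, after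
killing this value, the antisymmetrisation of a bilinear form with `x` and `y` in its right
kernel. -/
theorem exists_antisymm_eq_of_order {Z T : Type*} [AddCommGroup Z] [AddCommGroup T] {p m : ℕ}
    (hp : p.Prime) (hodd : Odd p) (hV : ∀ v : V, p ^ (m + 1) • v = 0)
    (α : V →ₗ[ℤ] V →ₗ[ℤ] Z) (hα : ∀ v, α v v = 0) (q : Z →ₗ[ℤ] T) (x y : V)
    (hq : q (α x y) = 0) (hord : ∀ a : ℤ, a • α x y = 0 → (p : ℤ) ^ m ∣ a) :
    ∃ β : V →ₗ[ℤ] V →ₗ[ℤ] T, (∀ s t, β s t - β t s = q (α s t)) ∧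
      (∀ s, β s x = 0) ∧ ∀ s, β s y = 0 := by
  have hneg : ∀ s t, α t s = - α s t := fun s t => by
    have := LinearMap.IsAlt.neg (B := α) hα s t
    rw [← this]
  have hrel : ∀ a b : ℤ, a • x + b • y = 0 → (p : ℤ) ^ m ∣ a ∧ (p : ℤ) ^ m ∣ b := by
    intro a b h
    constructor
    · apply hord
      have := congrArg (fun v => α v y) h
      simpa [hα] using this
    · apply hord
      have := congrArg (fun v => α x v) h
      simpa [hα] using this
  -- If `p ^ m` kills at most a line of combinations, level `k = m` works because `p ^ (m + 1) • V =
  -- 0`. Otherwise it kills both `x` and `y`, and the level drops by one.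
  by_cases hK : ∀ a b c d : ℤ, p ^ m • (a • x + b • y) = 0 → p ^ m • (c • x + d • y) = 0 →
      (p : ℤ) ∣ a * d - b * c
  · refine exists_antisymm_eq_of_det (k := m) hp hodd hV (α.compr₂ q) (fun v => by simp [hα])
      x y (by simpa using hq) (hV x) (hV y) (fun g a b h => ?_) (fun g h a b c d h1 h2 => ?_)
    · rw [hV] at h
      exact hrel a b h.symm
    · rw [hV] at h1 h2
      exact hK a b c d h1.symm h2.symm
  · push Not at hK
    obtain ⟨a, b, c, d, h1, h2, h3⟩ := hK
    obtain ⟨u, w, huw⟩ : IsCoprime (p : ℤ) (a * d - b * c) :=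
      (Nat.prime_iff_prime_int.1 hp).coprime_iff_not_dvd.2 h3
    have hx := hV x
    have hy := hV y
    simp only [← natCast_zsmul, Nat.cast_pow] at h1 h2 hx hy
    have hx : p ^ m • x = 0 := by
      simp only [← natCast_zsmul, Nat.cast_pow]
      linear_combination (norm := module) u • hx + (w * d) • h1 - (w * b) • h2
        - huw • ((p : ℤ) ^ m • x)
    have hy : p ^ m • y = 0 := by
      simp only [← natCast_zsmul, Nat.cast_pow]
      linear_combination (norm := module) u • hy - (w * c) • h1 + (w * a) • h2
        - huw • ((p : ℤ) ^ m • y)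
    obtain _ | k := m
    · obtain ⟨β, hβ, -⟩ := exists_antisymm_eq_of_pow_smul hp hodd hV 1 0 rfl (α.compr₂ q)
        (fun v => by simp [hα]) 0
      simp only [pow_zero, one_smul] at hx hy
      exact ⟨β, hβ, by simp [hx], by simp [hy]⟩
    · refine exists_antisymm_eq_of_det (k := k) hp hodd hV (α.compr₂ q) (fun v => by simp [hα])
        x y (by simpa using hq) hx hy (fun g a b h => ?_) (fun g h a b c d h1 h2 => ?_)
      · have h' : ((p : ℤ) * a) • x + ((p : ℤ) * b) • y = 0 := by
          rw [mul_smul, mul_smul, ← smul_add, ← h, natCast_zsmul, smul_smul, ← pow_succ', hV]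
        have hp0 : (p : ℤ) ≠ 0 := by exact_mod_cast hp.ne_zero
        obtain ⟨h1, h2⟩ := hrel _ _ h'
        rw [pow_succ'] at h1 h2
        exact ⟨(mul_dvd_mul_iff_left hp0).1 h1, (mul_dvd_mul_iff_left hp0).1 h2⟩
      · have hp0 : (p : ℤ) ^ k ≠ 0 := by exact_mod_cast (pow_pos hp.pos k).ne'
        -- Moving powers of `p` across `α` yields a multiple of `p ^ (k + 2)`, which kills `V`. Thus
        -- `p ^ k` times the determinant kills `α x y`, and the order hypothesis gives the extra
        -- factor `p`.
        have e1 : α (p ^ k • (a • x + b • y)) (c • x + d • y) = 0 := by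
          have : α (p ^ (k + 1) • g) (c • x + d • y) = p • α g (p ^ k • (c • x + d • y)) := by
            simp only [map_nsmul, LinearMap.smul_apply, smul_smul, pow_succ']
          rw [← h1, this, ← h2, ← map_nsmul, smul_smul, ← pow_succ', hV, map_zero]
        have e2 := hord ((p : ℤ) ^ k * (a * d - b * c)) (by
          simp only [map_nsmul, map_add, map_zsmul, LinearMap.add_apply, LinearMap.smul_apply,
            hα, hneg x y] at e1
          rw [← e1, ← natCast_zsmul]
          push_cast
          module)
        rw [pow_succ] at e2
        exact (mul_dvd_mul_iff_left hp0).1 e2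

end Additive

/-! ### Groups of nilpotency class at most two -/

theorem IsNilTwo.comm {G : Type v} [Group G] (h : IsNilTwo G) (a b c : G) :
    ⁅a, b⁆ * c = c * ⁅a, b⁆ :=
  (Subgroup.mem_center_iff.1 (h (Subgroup.commutator_mem_commutator
    (Subgroup.mem_top a) (Subgroup.mem_top b))) c).symm

theorem isNilTwo_of_comm {G : Type v} [Group G] (h : ∀ a b c : G, ⁅a, b⁆ * c = c * ⁅a, b⁆) :
    IsNilTwo G := by
  refine Subgroup.commutator_le.2 fun a _ b _ => Subgroup.mem_center_iff.2 fun c => (h a b c).symm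

theorem IsNilTwo.of_injective {G : Type u} {H : Type v} [Group G] [Group H] (f : G →* H)
    (hf : Function.Injective f) (h : IsNilTwo H) : IsNilTwo G :=
  isNilTwo_of_comm fun a b c => hf (by
    simp only [map_mul, map_commutatorElement, h.comm])

theorem IsNilTwo.of_surjective {G : Type u} {H : Type v} [Group G] [Group H] (f : G →* H)
    (hf : Function.Surjective f) (h : IsNilTwo G) : IsNilTwo H :=
  isNilTwo_of_comm fun a b c => by
    obtain ⟨a, rfl⟩ := hf a
    obtain ⟨b, rfl⟩ := hf b
    obtain ⟨c, rfl⟩ := hf c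
    simp only [← map_commutatorElement, ← map_mul, h.comm]

theorem IsNilTwo.prod {G : Type u} {H : Type v} [Group G] [Group H] (hG : IsNilTwo G)
    (hH : IsNilTwo H) : IsNilTwo (G × H) :=
  isNilTwo_of_comm fun a b c => by
    ext
    · exact hG.comm a.1 b.1 c.1
    · exact hH.comm a.2 b.2 c.2

section Class

variable {G : Type v} [Group G]

theorem IsNilTwo.commutatorElement_mul_left (h : IsNilTwo G) (a b c : G) :
    ⁅a * b, c⁆ = ⁅a, c⁆ * ⁅b, c⁆ := by
  have : ⁅a * b, c⁆ = a * ⁅b, c⁆ * (c * a⁻¹ * c⁻¹) := by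
    simp only [commutatorElement_def]; group
  rw [this, ← h.comm, mul_assoc, h.comm b c]
  simp only [commutatorElement_def]; group

theorem IsNilTwo.commutatorElement_mul_right (h : IsNilTwo G) (a b c : G) :
    ⁅a, b * c⁆ = ⁅a, b⁆ * ⁅a, c⁆ := by
  rw [← inv_inj, commutatorElement_inv, h.commutatorElement_mul_left, mul_inv_rev,
    commutatorElement_inv, commutatorElement_inv, h.comm]

/-- The commutator map of a group of class at most two, as a bilinear map. -/
def IsNilTwo.commHom (h : IsNilTwo G) : G →* G →* Subgroup.center G :=
  MonoidHom.mk' (fun a => MonoidHom.mk' (fun b => ⟨⁅a, b⁆, h (Subgroup.commutator_mem_commutator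
    (Subgroup.mem_top a) (Subgroup.mem_top b))⟩)
    fun b c => Subtype.ext (h.commutatorElement_mul_right a b c))
    fun a b => by
      ext c
      exact h.commutatorElement_mul_left a b c

theorem IsNilTwo.coe_commHom (h : IsNilTwo G) (a b : G) : (h.commHom a b : G) = ⁅a, b⁆ := rfl

theorem IsNilTwo.commutatorElement_pow_left (h : IsNilTwo G) (a b : G) (k : ℕ) :
    ⁅a ^ k, b⁆ = ⁅a, b⁆ ^ k := by
  rw [← h.coe_commHom, map_pow, MonoidHom.pow_apply, Subgroup.coe_pow, h.coe_commHom]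

theorem IsNilTwo.commutatorElement_pow_right (h : IsNilTwo G) (a b : G) (k : ℕ) :
    ⁅a, b ^ k⁆ = ⁅a, b⁆ ^ k := by
  rw [← h.coe_commHom, map_pow, Subgroup.coe_pow, h.coe_commHom]

theorem IsNilTwo.commutatorElement_zpow (h : IsNilTwo G) (a b : G) (k l : ℤ) :
    ⁅a ^ k, b ^ l⁆ = ⁅a, b⁆ ^ (k * l) := by
  rw [← h.coe_commHom, map_zpow, map_zpow, MonoidHom.zpow_apply, ← zpow_mul, Subgroup.coe_zpow,
    h.coe_commHom]

theorem IsNilTwo.mul_pow (h : IsNilTwo G) (a b : G) (k : ℕ) :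
    (a * b) ^ k = a ^ k * b ^ k * ⁅b, a⁆ ^ k.choose 2 := by
  induction k with
  | zero => simp
  | succ k ih =>
    have h1 : ∀ c, ⁅b, a⁆ ^ k.choose 2 * c = c * ⁅b, a⁆ ^ k.choose 2 := fun c =>
      ((show Commute ⁅b, a⁆ c from h.comm b a c).pow_left _).eq
    have h2 : b ^ k * a = ⁅b, a⁆ ^ k * (a * b ^ k) := by
      rw [← h.commutatorElement_pow_left, commutatorElement_def]; group
    have h3 : ∀ c, ⁅b, a⁆ ^ k * c = c * ⁅b, a⁆ ^ k := fun c =>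
      ((show Commute ⁅b, a⁆ c from h.comm b a c).pow_left _).eq
    have h4 : (k + 1).choose 2 = k + k.choose 2 := by
      rw [Nat.choose_succ_succ' k 1, Nat.choose_one_right]
    calc (a * b) ^ (k + 1) = a ^ k * b ^ k * ⁅b, a⁆ ^ k.choose 2 * (a * b) := by rw [pow_succ, ih]
      _ = a ^ k * (b ^ k * a) * b * ⁅b, a⁆ ^ k.choose 2 := by
        rw [mul_assoc, h1]; group
      _ = a ^ k * (⁅b, a⁆ ^ k * (a * b ^ k * b)) * ⁅b, a⁆ ^ k.choose 2 := by
        rw [h2]; simp only [mul_assoc]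
      _ = a ^ (k + 1) * b ^ (k + 1) * ⁅b, a⁆ ^ (k + 1).choose 2 := by
        rw [h3, h4, pow_add _ k (k.choose 2), pow_succ, pow_succ]; simp only [mul_assoc]

theorem Odd.dvd_choose_two {m : ℕ} (hm : Odd m) : m ∣ m.choose 2 := by
  obtain ⟨c, rfl⟩ := hm
  rw [Nat.choose_two_right, Nat.add_sub_cancel, mul_comm 2 c, ← mul_assoc,
    Nat.mul_div_cancel _ two_pos]
  exact Dvd.intro c rfl

/-- In class two and for odd `m`, the elements of exponent `m` form a subgroup. -/
theorem IsNilTwo.hasExp_of_closure (h : IsNilTwo G) {m : ℕ} (hm : Odd m) (s : Set G)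
    (hs : Subgroup.closure s = ⊤) (hsm : ∀ g ∈ s, g ^ m = 1) : HasExp m G := by
  intro g
  have hg : g ∈ Subgroup.closure s := hs ▸ Subgroup.mem_top g
  induction hg using Subgroup.closure_induction with
  | mem x hx => exact hsm x hx
  | one => exact one_pow m
  | mul x y _ _ hx hy =>
    obtain ⟨c, hc⟩ := hm.dvd_choose_two
    rw [h.mul_pow, hx, hy, hc, pow_mul, ← h.commutatorElement_pow_left, hy]
    simp
  | inv x _ hx => rw [inv_pow, hx, inv_one]

end Class

/-! ### Central extensions by bilinear cocycles -/

/-- The central extension of `P` by `T` with cocycle `ω`. -/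
@[ext]
structure BilinExt {P : Type u} {T : Type v} [Group P] [CommGroup T] (ω : P →* P →* T) where
  /-- The component in the quotient. -/
  fst : P
  /-- The component in the central subgroup. -/
  snd : T

namespace BilinExt

variable {P : Type u} {T : Type v} [Group P] [CommGroup T] {ω : P →* P →* T}

instance : Mul (BilinExt ω) := ⟨fun a b => ⟨a.fst * b.fst, a.snd * b.snd * ω a.fst b.fst⟩⟩
instance : One (BilinExt ω) := ⟨⟨1, 1⟩⟩
instance : Inv (BilinExt ω) := ⟨fun a => ⟨a.fst⁻¹, a.snd⁻¹ * ω a.fst a.fst⟩⟩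

@[simp] theorem fst_mul (a b : BilinExt ω) : (a * b).fst = a.fst * b.fst := rfl
@[simp] theorem snd_mul (a b : BilinExt ω) : (a * b).snd = a.snd * b.snd * ω a.fst b.fst := rfl
@[simp] theorem fst_one : (1 : BilinExt ω).fst = 1 := rfl
@[simp] theorem snd_one : (1 : BilinExt ω).snd = 1 := rfl
@[simp] theorem fst_inv (a : BilinExt ω) : a⁻¹.fst = a.fst⁻¹ := rfl
@[simp] theorem snd_inv (a : BilinExt ω) : a⁻¹.snd = a.snd⁻¹ * ω a.fst a.fst := rfl

instance : Group (BilinExt ω) :=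
  Group.ofLeftAxioms
    (fun a b c => by
      ext
      · simp [mul_assoc]
      · simp only [snd_mul, fst_mul, map_mul, MonoidHom.mul_apply]
        simp only [mul_assoc, mul_left_comm, mul_comm])
    (fun a => by ext <;> simp)
    (fun a => by ext <;> simp)

variable (ω) in
/-- The projection to the quotient. -/
@[simps]
def fstHom : BilinExt ω →* P where
  toFun := fst
  map_one' := rfl
  map_mul' _ _ := rfl

variable (ω) in
/-- The inclusion of the central subgroup. -/
@[simps]
def inr : T →* BilinExt ω where
  toFun t := ⟨1, t⟩
  map_one' := rfl
  map_mul' _ _ := by ext <;> simp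

theorem isNilTwo (hP : IsNilTwo P) : IsNilTwo (BilinExt ω) :=
  isNilTwo_of_comm fun a b c => by
    have h1 : (⁅a, b⁆ : BilinExt ω).fst = ⁅a.fst, b.fst⁆ := map_commutatorElement (fstHom ω) a b
    have h2 : ω ⁅a.fst, b.fst⁆ = 1 := by
      rw [map_commutatorElement, commutatorElement_eq_one_iff_mul_comm, mul_comm]
    have h3 : ω c.fst ⁅a.fst, b.fst⁆ = 1 := by
      rw [map_commutatorElement, commutatorElement_eq_one_iff_mul_comm, mul_comm]
    ext
    · rw [fst_mul, fst_mul, h1, hP.comm]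
    · simp [h1, h2, h3, mul_comm]

theorem hasExp {m : ℕ} (hm : Odd m) (hP : HasExp m P) (hT : HasExp m T) :
    HasExp m (BilinExt ω) := by
  have key : ∀ (a : BilinExt ω) (k : ℕ),
      a ^ k = ⟨a.fst ^ k, a.snd ^ k * ω a.fst a.fst ^ k.choose 2⟩ := by
    intro a k
    induction k with
    | zero => ext <;> simp
    | succ k ih =>
      rw [pow_succ, ih, Nat.choose_succ_succ' k 1, Nat.choose_one_right]
      ext
      · simp [pow_succ]
      · simp only [snd_mul, map_pow, MonoidHom.pow_apply, pow_succ, pow_add, mul_assoc,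
          mul_left_comm, mul_comm]
  intro a
  obtain ⟨c, hc⟩ := hm.dvd_choose_two
  rw [key, hP, hT, hc, pow_mul, hT]
  ext <;> simp

end BilinExt

theorem IsNilTwoExp.of_injective {m : ℕ} {G : Type u} {H : Type v} [Group G] [Group H]
    (f : G →* H) (hf : Function.Injective f) (h : IsNilTwoExp m H) : IsNilTwoExp m G :=
  ⟨h.1.of_injective f hf, fun g => hf (by rw [map_pow, h.2, map_one])⟩

/-! ### The presented group -/

theorem map_grpComm {G : Type u} {H : Type v} [Group G] [Group H] (f : G →* H) (a b : G) :
    f (grpComm a b) = grpComm (f a) (f b) := by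
  simp [grpComm]

theorem grpComm_eq {G : Type u} [Group G] (a b : G) : grpComm a b = ⁅a⁻¹, b⁻¹⁆ := by
  simp [grpComm, commutatorElement_def]

theorem IsNilTwo.grpComm_eq {G : Type u} [Group G] (h : IsNilTwo G) (a b : G) :
    grpComm a b = ⁅a, b⁆ := by
  have := h.commutatorElement_zpow a b (-1) (-1)
  rw [_root_.grpComm_eq]
  simpa using this

theorem isNilTwo_nilTwoPresented {α : Type v} (rels : Set (FreeGroup α)) :
    IsNilTwo (NilTwoPresented rels) := by
  refine isNilTwo_of_comm fun a b c => ?_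
  obtain ⟨a, rfl⟩ := PresentedGroup.mk_surjective _ a
  obtain ⟨b, rfl⟩ := PresentedGroup.mk_surjective _ b
  obtain ⟨c, rfl⟩ := PresentedGroup.mk_surjective _ c
  have h := PresentedGroup.one_of_mem
    (rels := rels ∪ {t | ∃ a b c : FreeGroup α, t = grpComm (grpComm a b) c})
    (Or.inr ⟨a⁻¹, b⁻¹, c, rfl⟩)
  rw [grpComm_eq a⁻¹, inv_inv, inv_inv, map_grpComm, map_commutatorElement, grpComm_eq,
    commutatorElement_eq_one_iff_commute] at h
  exact (Commute.inv_inv_iff.1 h).eq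

namespace BaseGroup

variable (p n : ℕ)

/-- The first generator. -/
def x : BaseGroup p n := PresentedGroup.of 0

/-- The second generator. -/
def y : BaseGroup p n := PresentedGroup.of 1

theorem isNilTwo : IsNilTwo (BaseGroup p n) := isNilTwo_nilTwoPresented _

theorem mk_eq_one {t : FreeGroup (Fin 2)} (ht : t ∈ baseRels p n) :
    (PresentedGroup.mk _ t : BaseGroup p n) = 1 :=
  PresentedGroup.one_of_mem (Or.inl ht)

theorem x_pow : x p n ^ p ^ n = 1 := mk_eq_one p n (Or.inl rfl)

theorem y_pow : y p n ^ p ^ n = 1 := mk_eq_one p n (Or.inr (Or.inl rfl))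

theorem commutator_pow : ⁅x p n, y p n⁆ ^ p ^ (n - 1) = 1 := by
  have := mk_eq_one p n (Or.inr (Or.inr rfl))
  rwa [map_pow, map_grpComm, (isNilTwo p n).grpComm_eq] at this

theorem closure_eq_top : Subgroup.closure {x p n, y p n} = ⊤ := by
  rw [← PresentedGroup.closure_range_of]
  congr 1
  ext g
  simp [x, y, Fin.exists_fin_two, eq_comm]

theorem isNilTwoExp {p : ℕ} (hodd : Odd p) : IsNilTwoExp (p ^ n) (BaseGroup p n) := by
  refine ⟨isNilTwo p n, (isNilTwo p n).hasExp_of_closure hodd.pow _ (closure_eq_top p n) ?_⟩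
  rintro g (rfl | rfl)
  · exact x_pow p n
  · exact y_pow p n

theorem exists_normal_form (g : BaseGroup p n) :
    ∃ a b c : ℤ, g = x p n ^ a * y p n ^ b * ⁅x p n, y p n⁆ ^ c := by
  have h := isNilTwo p n
  have hg : g ∈ Subgroup.closure {x p n, y p n} := closure_eq_top p n ▸ Subgroup.mem_top g
  have hcomm : ∀ (c : ℤ) (g : BaseGroup p n),
      ⁅x p n, y p n⁆ ^ c * g = g * ⁅x p n, y p n⁆ ^ c := fun c g =>
    ((show Commute ⁅x p n, y p n⁆ g from h.comm _ _ g).zpow_left c).eq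
  have hyx : ∀ ε a : ℤ, y p n ^ ε * x p n ^ a =
      x p n ^ a * y p n ^ ε * ⁅x p n, y p n⁆ ^ (-(a * ε)) := by
    intro ε a
    rw [zpow_neg, ← h.commutatorElement_zpow, ← commutatorElement_inv, inv_inv, ← h.comm,
      commutatorElement_def]
    group
  have hx : ∀ ε a b c : ℤ, x p n ^ ε * (x p n ^ a * y p n ^ b * ⁅x p n, y p n⁆ ^ c) =
      x p n ^ (ε + a) * y p n ^ b * ⁅x p n, y p n⁆ ^ c := by
    intro ε a b c; rw [zpow_add]; simp only [mul_assoc]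
  have hy : ∀ ε a b c : ℤ, y p n ^ ε * (x p n ^ a * y p n ^ b * ⁅x p n, y p n⁆ ^ c) =
      x p n ^ a * y p n ^ (ε + b) * ⁅x p n, y p n⁆ ^ (-(a * ε) + c) := by
    intro ε a b c
    rw [← mul_assoc, ← mul_assoc, hyx, mul_assoc (x p n ^ a * y p n ^ ε), hcomm, zpow_add, zpow_add]
    simp only [mul_assoc]
  induction hg using Subgroup.closure_induction_left with
  | one => exact ⟨0, 0, 0, by simp⟩
  | mul_left s hs g _ ih =>
    obtain ⟨a, b, c, rfl⟩ := ih
    rcases hs with rfl | rfl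
    · exact ⟨_, _, _, by simpa using hx 1 a b c⟩
    · exact ⟨_, _, _, by simpa using hy 1 a b c⟩
  | inv_mul_cancel s hs g _ ih =>
    obtain ⟨a, b, c, rfl⟩ := ih
    rcases hs with rfl | rfl
    · exact ⟨_, _, _, by simpa using hx (-1) a b c⟩
    · exact ⟨_, _, _, by simpa using hy (-1) a b c⟩

variable {p n} in
theorem exists_hom {H : Type u} [Group H] (hH : IsNilTwo H) (r s : H) (hr : r ^ p ^ n = 1)
    (hs : s ^ p ^ n = 1) (hrs : ⁅r, s⁆ ^ p ^ (n - 1) = 1) :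
    ∃ f : BaseGroup p n →* H, f (x p n) = r ∧ f (y p n) = s := by
  refine ⟨PresentedGroup.toGroup (f := ![r, s]) ?_, ?_, ?_⟩
  · rintro t ((rfl | rfl | rfl) | ⟨a, b, c, rfl⟩)
    · simpa using hr
    · simpa using hs
    · simpa [map_grpComm, hH.grpComm_eq] using hrs
    · rw [map_grpComm, map_grpComm, hH.grpComm_eq, hH.grpComm_eq,
        commutatorElement_eq_one_iff_mul_comm, hH.comm]
  · simp [x]
  · simp [y]

end BaseGroup

/-! ### A free object of exponent `q` on two generators -/

/-- The cocycle `(a, b), (c, d) ↦ a * d` on pairs over `ZMod q`. -/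
def heisCocycle (q : ℕ) : Multiplicative (ZMod q × ZMod q) →* Multiplicative (ZMod q × ZMod q) →*
    Multiplicative (ZMod q) :=
  MonoidHom.mk' (fun a => MonoidHom.mk'
    (fun b => Multiplicative.ofAdd ((Multiplicative.toAdd a).1 * (Multiplicative.toAdd b).2))
    fun b c => by simp [← ofAdd_add, mul_add])
    fun a b => by ext c; simp [← ofAdd_add, add_mul]

theorem heisCocycle_apply {q : ℕ} (a b : Multiplicative (ZMod q × ZMod q)) :
    heisCocycle q a b =
      Multiplicative.ofAdd ((Multiplicative.toAdd a).1 * (Multiplicative.toAdd b).2) := rfl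

theorem exists_heisenberg {q : ℕ} (hq : Odd q) :
    ∃ (H : Type) (_ : Group H) (r s : H), IsNilTwoExp q H ∧
      (∀ a b c : ℤ, r ^ a * s ^ b * ⁅r, s⁆ ^ c = 1 → (q : ℤ) ∣ a ∧ (q : ℤ) ∣ b ∧ (q : ℤ) ∣ c) := by
  have hexp : ∀ g : Multiplicative (ZMod q), g ^ q = 1 := fun g => by
    have : q • Multiplicative.toAdd g = 0 := by simp
    exact this
  have hexp2 : ∀ g : Multiplicative (ZMod q × ZMod q), g ^ q = 1 := fun g => by
    have : q • Multiplicative.toAdd g = 0 := by ext <;> simp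
    exact this
  have hP : IsNilTwo (Multiplicative (ZMod q × ZMod q)) :=
    isNilTwo_of_comm fun a b c => mul_comm _ _
  let r : BilinExt (heisCocycle q) := ⟨Multiplicative.ofAdd (1, 0), 1⟩
  let s : BilinExt (heisCocycle q) := ⟨Multiplicative.ofAdd (0, 1), 1⟩
  have hrs : ⁅r, s⁆ = BilinExt.inr (heisCocycle q) (Multiplicative.ofAdd 1) := by
    rw [commutatorElement_def]
    ext <;> simp [r, s, heisCocycle_apply]
  refine ⟨BilinExt (heisCocycle q), inferInstance, r, s,
    ⟨BilinExt.isNilTwo hP, BilinExt.hasExp hq hexp2 hexp⟩, fun a b c h => ?_⟩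
  have h1 := congrArg (BilinExt.fstHom (heisCocycle q)) h
  rw [hrs] at h h1
  have h2 : (a : ZMod q) = 0 ∧ (b : ZMod q) = 0 := by
    simp only [map_mul, map_zpow, map_one] at h1
    have h2 := congrArg Multiplicative.toAdd h1
    simpa [r, s] using h2
  rw [ZMod.intCast_zmod_eq_zero_iff_dvd, ZMod.intCast_zmod_eq_zero_iff_dvd] at h2
  obtain ⟨⟨a, rfl⟩, ⟨b, rfl⟩⟩ := h2
  have hexpB := BilinExt.hasExp (ω := heisCocycle q) hq hexp2 hexp
  rw [zpow_mul, zpow_mul, zpow_natCast, zpow_natCast, hexpB, hexpB, one_zpow, one_zpow, one_mul,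
    one_mul] at h
  refine ⟨dvd_mul_right _ _, dvd_mul_right _ _, ?_⟩
  rw [← ZMod.intCast_zmod_eq_zero_iff_dvd]
  have h3 := congrArg (fun g => Multiplicative.toAdd (BilinExt.snd g)) h
  rw [← map_zpow] at h3
  change Multiplicative.toAdd (Multiplicative.ofAdd (1 : ZMod q) ^ c) = 0 at h3
  simpa using h3

/-! ### Roots of the generators, and failure in exponent `p ^ (n + 1)` -/

namespace BaseGroup

/-- The base group sits in a group of class two and exponent `p ^ (n + 1)` in which its generators
have `p`-th roots `r` and `s` such that `⁅r, s⁆ ^ p` is a new element. -/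
theorem exists_roots {p n : ℕ} (hp : p.Prime) (hodd : Odd p) (hn : 0 < n) :
    ∃ (H : Type) (_ : Group H) (f : BaseGroup p n →* H) (r s : H), IsNilTwoExp (p ^ (n + 1)) H ∧
      Function.Injective f ∧ f (x p n) = r ^ p ∧ f (y p n) = s ^ p ∧ ⁅r, s⁆ ^ p ∉ f.range ∧
      ∀ c : ℤ, ⁅x p n, y p n⁆ ^ c = 1 → (p : ℤ) ^ (n - 1) ∣ c := by
  obtain ⟨H, _, r, s, hH, hrs⟩ := exists_heisenberg (hodd.pow (n := n + 1))
  have hrs' : ⁅r ^ p, s ^ p⁆ = ⁅r, s⁆ ^ (p * p) := by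
    rw [hH.1.commutatorElement_pow_left, hH.1.commutatorElement_pow_right, pow_mul]
  obtain ⟨f, hfx, hfy⟩ := exists_hom (p := p) (n := n) hH.1 (r ^ p) (s ^ p)
    (by rw [← pow_mul, ← pow_succ', hH.2]) (by rw [← pow_mul, ← pow_succ', hH.2])
    (by
      rw [hrs', ← pow_mul]
      obtain ⟨m, rfl⟩ : ∃ m, n = m + 1 := ⟨n - 1, by omega⟩
      rw [Nat.add_sub_cancel, show p * p * p ^ m = p ^ (m + 1 + 1) by ring, hH.2])
  have hfz : f ⁅x p n, y p n⁆ = ⁅r, s⁆ ^ (p * p) := by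
    rw [map_commutatorElement, hfx, hfy, hrs']
  have hp0 : (p : ℤ) ≠ 0 := by exact_mod_cast hp.ne_zero
  -- Taking `d = 0` gives injectivity and the order of the commutator; `d = p` excludes `⁅r, s⁆ ^
  -- p`, as `p * p` does not divide `p`.
  have key : ∀ a b c d : ℤ,
      f (x p n ^ a * y p n ^ b * ⁅x p n, y p n⁆ ^ c) = ⁅r, s⁆ ^ d →
      x p n ^ a = 1 ∧ y p n ^ b = 1 ∧ (p : ℤ) ^ (n + 1) ∣ p * p * c - d := by
    intro a b c d h
    rw [map_mul, map_mul, map_zpow, map_zpow, map_zpow, hfx, hfy, hfz, ← zpow_natCast,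
      ← zpow_natCast, ← zpow_natCast, ← zpow_mul, ← zpow_mul, ← zpow_mul, ← mul_inv_eq_one,
      mul_assoc, ← zpow_neg, ← zpow_add] at h
    obtain ⟨h1, h2, h3⟩ := hrs _ _ _ h
    push_cast at h1 h2 h3
    rw [pow_succ', mul_dvd_mul_iff_left hp0] at h1 h2
    obtain ⟨a, rfl⟩ := h1
    obtain ⟨b, rfl⟩ := h2
    refine ⟨?_, ?_, by rwa [sub_eq_add_neg]⟩
    · rw [zpow_mul, ← Nat.cast_pow, zpow_natCast, x_pow, one_zpow]
    · rw [zpow_mul, ← Nat.cast_pow, zpow_natCast, y_pow, one_zpow]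
  have hdvd : ∀ c : ℤ, (p : ℤ) ^ (n + 1) ∣ p * p * c - 0 → (p : ℤ) ^ (n - 1) ∣ c := by
    intro c h
    obtain ⟨m, rfl⟩ : ∃ m, n = m + 1 := ⟨n - 1, by omega⟩
    rw [sub_zero, pow_succ', pow_succ', mul_assoc, mul_dvd_mul_iff_left hp0,
      mul_dvd_mul_iff_left hp0] at h
    simpa using h
  refine ⟨H, inferInstance, f, r, s, hH, ?_, hfx, hfy, ?_, ?_⟩
  · rw [injective_iff_map_eq_one]
    intro g hg
    obtain ⟨a, b, c, rfl⟩ := exists_normal_form p n g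
    obtain ⟨h1, h2, h3⟩ := key a b c 0 (by rw [hg, zpow_zero])
    obtain ⟨c, rfl⟩ := hdvd c h3
    rw [h1, h2, zpow_mul, ← Nat.cast_pow, zpow_natCast, commutator_pow]
    simp
  · rintro ⟨g, hg⟩
    obtain ⟨a, b, c, rfl⟩ := exists_normal_form p n g
    obtain ⟨-, -, h3⟩ := key a b c p (by rw [hg, zpow_natCast])
    have h4 : (p : ℤ) * p ∣ p * p * c - p :=
      dvd_trans (by rw [← sq]; exact pow_dvd_pow _ (by omega)) h3
    rw [dvd_sub_right (dvd_mul_right _ _)] at h4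
    have h5 : (p : ℤ) * p ∣ p * 1 := by simpa using h4
    rw [mul_dvd_mul_iff_left hp0] at h5
    exact (Nat.prime_iff_prime_int.1 hp).not_isUnit (isUnit_of_dvd_one h5)
  · intro c hc
    refine hdvd c (key 0 0 c 0 ?_).2.2
    rw [hc]; simp

/-- The two maps agree on `r ^ p` and `s ^ p`. Since `⁅r, s⁆ ^ p` equals both `⁅r ^ p, s⁆` and `⁅r,
s ^ p⁆`, one may pass from the first copy to the second one argument at a time. -/
theorem not_absolutelyClosed {p n : ℕ} (hp : p.Prime) (hodd : Odd p) (hn : 0 < n) :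
    ¬ AbsolutelyClosed (fun (H : Type u) [Group H] => IsNilTwoExp (p ^ (n + 1)) H)
        (BaseGroup p n) := by
  intro hcl
  obtain ⟨H, _, f, r, s, hH, hf, hx, hy, hrs, -⟩ := exists_roots hp hodd hn
  let e : ULift.{u} H ≃* H := MulEquiv.ulift
  have hA : IsNilTwoExp (p ^ (n + 1)) (ULift.{u} H) :=
    hH.of_injective e.toMonoidHom e.injective
  let Φ : BaseGroup p n →* ULift.{u} H := e.symm.toMonoidHom.comp f
  have hΦ : Function.Injective Φ := e.symm.injective.comp hf
  obtain ⟨M, _, hM, l, l', l₀, -, -, -, hl, hl', hne⟩ := hcl (ULift.{u} H) (ULift.{u} H) hA hA Φ Φ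
    ⟨hΦ, hΦ, MulEquiv.refl _, rfl⟩
  have hmem : ⁅e.symm r, e.symm s⁆ ^ p ∉ Φ.range := by
    rintro ⟨g, hg⟩
    refine hrs ⟨g, ?_⟩
    have := congrArg e hg
    simpa [Φ, map_commutatorElement] using this
  have h1 : l (e.symm r) ^ p = l' (e.symm r) ^ p := by
    have hr : (e.symm r) ^ p = Φ (x p n) := by simp [Φ, hx]
    rw [← map_pow l, ← map_pow l', hr]
    exact DFunLike.congr_fun (hl.trans hl'.symm) _
  have h2 : l (e.symm s) ^ p = l' (e.symm s) ^ p := by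
    have hs : (e.symm s) ^ p = Φ (y p n) := by simp [Φ, hy]
    rw [← map_pow l, ← map_pow l', hs]
    exact DFunLike.congr_fun (hl.trans hl'.symm) _
  refine hne _ hmem _ hmem ?_
  rw [map_pow, map_pow, map_commutatorElement, map_commutatorElement,
    ← hM.1.commutatorElement_pow_left, h1, hM.1.commutatorElement_pow_left,
    ← hM.1.commutatorElement_pow_right, h2, hM.1.commutatorElement_pow_right]

end BaseGroup

/-! ### Strong embeddings from bilinear forms -/

theorem MonoidHom.apply_eq_one_of_mem_commutator {A : Type u} {T : Type v} [Group A] [CommGroup T]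
    (f : A →* T) {z : A} (hz : z ∈ commutator A) : f z = 1 :=
  MonoidHom.mem_ker.1 (Abelianization.commutator_subset_ker f hz)

section Embedding

variable {A : Type u} [Group A] {T : Type u} [CommGroup T]

/-- The cocycle `(a, e), (a', e') ↦ β (a / e) e'` on `A × A`. -/
def diffCocycle (β : A →* A →* T) : A × A →* A × A →* T :=
  MonoidHom.mk' (fun P => (β P.1 / β P.2).comp (MonoidHom.snd A A)) fun P Q => by
    ext R
    all_goals simp [mul_div_mul_comm]

@[simp]
theorem diffCocycle_apply (β : A →* A →* T) (P Q : A × A) :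
    diffCocycle β P Q = β P.1 Q.2 / β P.2 Q.2 := rfl

/-- The subgroup that is factored out of the extension in order to identify two copies of `B`. -/
def gluingSubgroup (B : Subgroup A) (β : A →* A →* T) (φ : Subgroup.center A →* T)
    (hB : ∀ s, ∀ b ∈ B, β s b = 1) : Subgroup (BilinExt (diffCocycle β)) where
  -- The pair `(1, b)` is the discrepancy between the copies `(b, 1)` and `(b, b)`. Conjugation by
  -- `(a, e)` multiplies `b` by `⁅e, b⁆` and the central coordinate by `β b e = (φ ⁅e, b⁆)⁻¹`; the
  -- factor `z` absorbs this.
  carrier := {g | g.fst.1 = 1 ∧ ∃ z : Subgroup.center A, (z : A) ∈ commutator A ∧ ∃ b ∈ B,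
    g.fst.2 = z * b ∧ g.snd = (φ z)⁻¹}
  one_mem' := ⟨rfl, 1, Subgroup.one_mem _, 1, Subgroup.one_mem _, by simp, by simp⟩
  mul_mem' := by
    rintro g h ⟨h1, z, hz, b, hb, h2, h3⟩ ⟨k1, w, hw, c, hc, k2, k3⟩
    refine ⟨by simp [h1, k1], z * w, Subgroup.mul_mem _ hz hw, b * c, B.mul_mem hb hc, ?_, ?_⟩
    · have := Subgroup.mem_center_iff.1 w.2 b
      rw [BilinExt.fst_mul, Prod.snd_mul, h2, k2, Subgroup.coe_mul, mul_assoc, ← mul_assoc b, this]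
      simp only [mul_assoc]
    · have : ∀ s, β s (w * c) = 1 := fun s => by
        rw [map_mul, hB s c hc, (β s).apply_eq_one_of_mem_commutator hw, one_mul]
      simp [h3, k3, k2, this, -map_mul, map_mul φ, mul_comm]
  inv_mem' := by
    rintro g ⟨h1, z, hz, b, hb, h2, h3⟩
    refine ⟨by simp [h1], z⁻¹, Subgroup.inv_mem _ hz, b⁻¹, B.inv_mem hb, ?_, ?_⟩
    · have := Subgroup.mem_center_iff.1 (z⁻¹).2 b⁻¹
      rw [BilinExt.fst_inv, Prod.snd_inv, h2, mul_inv_rev, ← this]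
      simp
    · have : ∀ s, β s (z * b) = 1 := fun s => by
        rw [map_mul, hB s b hb, (β s).apply_eq_one_of_mem_commutator hz, one_mul]
      simp [h3, h2, this, -map_mul]

theorem gluingSubgroup_normal (hA : IsNilTwo A) (B : Subgroup A) (β : A →* A →* T)
    (φ : Subgroup.center A →* T) (hB : ∀ s, ∀ b ∈ B, β s b = 1)
    (hβ : ∀ s t, β s t / β t s = φ (hA.commHom s t)) : (gluingSubgroup B β φ hB).Normal := by
  refine ⟨?_⟩
  rintro n ⟨h1, z, hz, b, hb, h2, h3⟩ g
  have hzb : ∀ s, β s (z * b) = 1 := fun s => by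
    rw [map_mul, hB s b hb, (β s).apply_eq_one_of_mem_commutator hz, one_mul]
  refine ⟨by simp [h1], hA.commHom g.fst.2 b * z, ?_, b, hb, ?_, ?_⟩
  · exact Subgroup.mul_mem _ (Subgroup.commutator_mem_commutator
      (Subgroup.mem_top _) (Subgroup.mem_top _)) hz
  · have := Subgroup.mem_center_iff.1 z.2
    simp only [BilinExt.fst_mul, BilinExt.fst_inv, Prod.snd_mul, Prod.snd_inv, h2,
      Subgroup.coe_mul, hA.coe_commHom, commutatorElement_def]
    rw [← mul_assoc g.fst.2, this g.fst.2, this]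
    group
  · have h4 : β z = 1 := β.apply_eq_one_of_mem_commutator hz
    have h5 : φ (hA.commHom g.fst.2 b) = (β b g.fst.2)⁻¹ := by
      rw [← hβ, hB _ b hb, one_div]
    rw [map_mul φ, h5]
    simp only [BilinExt.snd_mul, BilinExt.fst_mul, BilinExt.snd_inv, BilinExt.fst_inv,
      diffCocycle_apply, Prod.fst_mul, Prod.snd_mul, map_inv, map_mul β, h1, h2,
      h3, h4, hzb, map_one, MonoidHom.mul_apply, MonoidHom.one_apply]
    generalize β g.fst.1 g.fst.2 = u
    generalize β g.fst.2 g.fst.2 = v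
    generalize β b g.fst.2 = w
    apply Additive.ofMul.injective
    simp only [ofMul_mul, ofMul_inv, ofMul_div, ofMul_one]
    abel

/-- The cocycle is trivial on `{(a, 1)}` and on the diagonal, so both copies of `A` lift. If `a` has
the same image under both, then `a = z * b` with `b` in the core, and comparing central coordinates
gives `φ z = 1`, so `z` is in the core too. -/
theorem stronglyEmbeddable_of_form {G : Type v} [Group G] {q : ℕ} (hq : Odd q)
    (hA : IsNilTwoExp q A) (hT : HasExp q T) (Φ : G →* A) (hΦ : Function.Injective Φ)
    (β : A →* A →* T) (φ : Subgroup.center A →* T) (hφ : ∀ z, φ z = 1 → (z : A) ∈ Φ.range)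
    (hB : ∀ s, ∀ b ∈ Φ.range, β s b = 1)
    (hβ : ∀ s t, β s t / β t s = φ (hA.1.commHom s t)) :
    StronglyEmbeddable (fun (H : Type u) [Group H] => IsNilTwoExp q H) Φ Φ := by
  let N := gluingSubgroup Φ.range β φ hB
  have hN : N.Normal := gluingSubgroup_normal hA.1 Φ.range β φ hB hβ
  have hE : IsNilTwoExp q (BilinExt (diffCocycle β)) :=
    ⟨BilinExt.isNilTwo (hA.1.prod hA.1), BilinExt.hasExp hq
      (fun g => Prod.ext (hA.2 g.1) (hA.2 g.2)) hT⟩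
  have hM : IsNilTwoExp q (BilinExt (diffCocycle β) ⧸ N) := by
    refine ⟨hE.1.of_surjective (QuotientGroup.mk' N) (QuotientGroup.mk'_surjective N), fun g => ?_⟩
    obtain ⟨g, rfl⟩ := QuotientGroup.mk'_surjective N g
    rw [← map_pow, hE.2, map_one]
  let l : A →* BilinExt (diffCocycle β) :=
    MonoidHom.mk' (fun a => ⟨(a, 1), 1⟩) fun a b => by ext <;> simp
  let l' : A →* BilinExt (diffCocycle β) :=
    MonoidHom.mk' (fun a => ⟨(a, a), 1⟩) fun a b => by ext <;> simp
  have hmem : ∀ g h : BilinExt (diffCocycle β), QuotientGroup.mk' N g = QuotientGroup.mk' N h →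
      g.fst.1 = h.fst.1 := by
    intro g h hgh
    have := (QuotientGroup.eq.1 hgh : g⁻¹ * h ∈ N).1
    simpa [inv_mul_eq_one] using this
  have hl : Function.Injective ((QuotientGroup.mk' N).comp l) := fun a b h => hmem _ _ h
  have hl' : Function.Injective ((QuotientGroup.mk' N).comp l') := fun a b h => hmem _ _ h
  refine ⟨BilinExt (diffCocycle β) ⧸ N, inferInstance, hM, (QuotientGroup.mk' N).comp l,
    (QuotientGroup.mk' N).comp l', ((QuotientGroup.mk' N).comp l).comp Φ, hl, hl',
    hl.comp hΦ, rfl, ?_, ?_⟩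
  · ext g
    refine (QuotientGroup.eq.2 ?_).symm
    refine ⟨by simp [l, l'], 1, Subgroup.one_mem _, Φ g, ⟨g, rfl⟩, by simp [l, l'], ?_⟩
    simp [l, l', hB _ _ ⟨g, rfl⟩]
  · intro a ha a' _ h
    obtain rfl : a = a' := hmem _ _ h
    obtain ⟨-, z, hz, b, hb, h2, h3⟩ := (QuotientGroup.eq.1 h : (l a)⁻¹ * l' a ∈ N)
    refine ha ?_
    have h2 : a = z * b := by simpa [l, l'] using h2
    have h4 : β a a = 1 := by
      have : β a (z * b) = 1 := by
        rw [map_mul, hB _ b hb, (β a).apply_eq_one_of_mem_commutator hz, one_mul]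
      rwa [← h2] at this
    have h3 : φ z = 1 := by simpa [l, l', h4, eq_comm] using h3
    rw [h2]
    exact Subgroup.mul_mem _ (hφ z h3) hb

end Embedding

theorem StronglyEmbeddable.of_special {C : (H : Type u) → [Group H] → Prop}
    {B : Type v} {A A' : Type u} [Group B] [Group A] [Group A'] {Φ : B →* A} {Φ' : B →* A'}
    (h : IsSpecialAmalgam Φ Φ') (hΦ : StronglyEmbeddable C Φ Φ) : StronglyEmbeddable C Φ Φ' := by
  obtain ⟨-, -, ψ, rfl⟩ := h
  obtain ⟨M, _, hM, l, l', l₀, hl, hl', hl₀, e, e', hne⟩ := hΦ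
  refine ⟨M, inferInstance, hM, l, l'.comp ψ.symm.toMonoidHom, l₀, hl,
    hl'.comp ψ.symm.injective, hl₀, e, ?_, ?_⟩
  · rw [← e']; ext b; simp
  · intro a ha a' ha'
    refine hne a ha _ ?_
    rintro ⟨b, hb⟩
    exact ha' ⟨b, by simp [hb]⟩

/-! ### The commutator form on the abelianization, and absolute closedness -/

/-- The bilinear map over `ℤ` given by a bihomomorphism of commutative groups. -/
def MonoidHom.toIntBilin {P : Type u} {Z : Type v} [CommGroup P] [CommGroup Z] (c : P →* P →* Z) :
    Additive P →ₗ[ℤ] Additive P →ₗ[ℤ] Additive Z :=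
  (AddMonoidHom.mk' (fun s => (MonoidHom.toAdditive (c s.toMul)).toIntLinearMap) fun s t => by
    ext r
    exact congrArg Additive.ofMul (DFunLike.congr_fun (map_mul c s.toMul t.toMul) r.toMul)
    ).toIntLinearMap

theorem MonoidHom.toIntBilin_apply {P : Type u} {Z : Type v} [CommGroup P] [CommGroup Z]
    (c : P →* P →* Z) (s t : Additive P) :
    c.toIntBilin s t = Additive.ofMul (c s.toMul t.toMul) := rfl

/-- The commutator map on the abelianization of a group of class two. -/
def IsNilTwo.abCommHom {A : Type u} [Group A] (hA : IsNilTwo A) :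
    Abelianization A →* Abelianization A →* Subgroup.center A :=
  Abelianization.lift (MonoidHom.mk' (fun a => Abelianization.lift (hA.commHom a)) fun a b => by
    ext c
    simp)

theorem IsNilTwo.abCommHom_of {A : Type u} [Group A] (hA : IsNilTwo A) (a b : A) :
    hA.abCommHom (Abelianization.of a) (Abelianization.of b) = hA.commHom a b := by
  simp [IsNilTwo.abCommHom]

theorem BaseGroup.absolutelyClosed {p n : ℕ} (hp : p.Prime) (hodd : Odd p) (hn : 0 < n) :
    AbsolutelyClosed (fun (H : Type u) [Group H] => IsNilTwoExp (p ^ n) H) (BaseGroup p n) := by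
  intro A A' _ _ hA _ Φ Φ' hΦ
  refine StronglyEmbeddable.of_special hΦ ?_
  obtain ⟨m, rfl⟩ : ∃ m, n = m + 1 := ⟨n - 1, by omega⟩
  obtain ⟨-, -, -, -, -, -, -, -, -, -, hord⟩ := exists_roots hp hodd hn
  -- Exactly the central elements of the core are killed: this includes `⁅X, Y⁆`, as the form needs,
  -- and nothing outside the core, as the gluing needs.
  let φ := QuotientGroup.mk' (Φ.range.subgroupOf (Subgroup.center A))
  have hφ : ∀ z, φ z = 1 ↔ (z : A) ∈ Φ.range := fun z => by
    rw [QuotientGroup.mk'_apply, QuotientGroup.eq_one_iff, Subgroup.mem_subgroupOf]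
  have hT : HasExp (p ^ (m + 1)) (Subgroup.center A ⧸ Φ.range.subgroupOf (Subgroup.center A)) := by
    intro g
    obtain ⟨g, rfl⟩ := QuotientGroup.mk'_surjective _ g
    rw [← map_pow, show g ^ p ^ (m + 1) = 1 from Subtype.ext (hA.2 (g : A))]
    exact map_one φ
  have hof : Function.Surjective (Abelianization.of (G := A)) := QuotientGroup.mk_surjective
  let X := Φ (x p (m + 1))
  let Y := Φ (y p (m + 1))
  have hXY : (hA.1.commHom X Y : A) = Φ ⁅x p (m + 1), y p (m + 1)⁆ := by
    rw [map_commutatorElement]; rfl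
  obtain ⟨β, hβ, hβX, hβY⟩ := exists_antisymm_eq_of_order (V := Additive (Abelianization A))
    (m := m) hp hodd
    (by
      intro v
      obtain ⟨a, ha⟩ := hof v.toMul
      have : v.toMul ^ p ^ (m + 1) = 1 := by rw [← ha, ← map_pow, hA.2, map_one]
      exact this)
    hA.1.abCommHom.toIntBilin
    (by
      intro v
      obtain ⟨a, ha⟩ := hof v.toMul
      rw [MonoidHom.toIntBilin_apply, ← ha, hA.1.abCommHom_of]
      exact Subtype.ext (commutatorElement_self a))
    (MonoidHom.toAdditive φ).toIntLinearMap
    (Additive.ofMul (Abelianization.of X)) (Additive.ofMul (Abelianization.of Y))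
    (by
      have : φ (hA.1.abCommHom (Abelianization.of X) (Abelianization.of Y)) = 1 := by
        rw [hA.1.abCommHom_of, hφ, hXY]
        exact ⟨_, rfl⟩
      exact this)
    (by
      intro a ha
      refine hord a (hΦ.1 ?_)
      have h1 : (hA.1.abCommHom (Abelianization.of X) (Abelianization.of Y)) ^ a = 1 := ha
      rw [hA.1.abCommHom_of] at h1
      have h2 := congrArg Subtype.val h1
      rw [Subgroup.coe_zpow, hXY] at h2
      rw [map_zpow, h2, map_one]; rfl)
  let β' : A →* A →* (Subgroup.center A ⧸ Φ.range.subgroupOf (Subgroup.center A)) :=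
    MonoidHom.mk' (fun a => MonoidHom.mk' (fun b => (β (Additive.ofMul (Abelianization.of a))
      (Additive.ofMul (Abelianization.of b))).toMul) fun b c => by simp) fun a b => by
        ext c; simp
  refine stronglyEmbeddable_of_form hodd.pow hA hT Φ hΦ.1 β' φ (fun z => (hφ z).1) ?_ ?_
  · rintro s b ⟨g, rfl⟩
    suffices h : (⊤ : Subgroup (BaseGroup p (m + 1))) ≤ ((β' s).comp Φ).ker from
      h (Subgroup.mem_top g)
    rw [← closure_eq_top, Subgroup.closure_le]
    rintro g (rfl | rfl)
    · exact hβX _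
    · exact hβY _
  · intro s t
    have h := hβ (Additive.ofMul (Abelianization.of s)) (Additive.ofMul (Abelianization.of t))
    rw [MonoidHom.toIntBilin_apply, toMul_ofMul, toMul_ofMul, hA.1.abCommHom_of] at h
    exact congrArg Additive.toMul h

theorem mainTheorem4 (p : ℕ) (hp : p.Prime) (hodd : Odd p) (n : ℕ) (hn : 0 < n) :
    IsNilTwoExp (p ^ n) (BaseGroup p n) ∧
      AbsolutelyClosed (fun (H : Type u) [Group H] => IsNilTwoExp (p ^ n) H) (BaseGroup p n) ∧
      ¬ AbsolutelyClosed (fun (H : Type u) [Group H] => IsNilTwoExp (p ^ (n + 1)) H)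
        (BaseGroup p n) :=
  ⟨BaseGroup.isNilTwoExp n hodd, BaseGroup.absolutelyClosed hp hodd hn,
    BaseGroup.not_absolutelyClosed hp hodd hn⟩
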